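/- For $1\le p<\infty$ let $\mathcal F_p$ be the Fock space of entire functions $f:\mathbb C\to\mathbb C$ with $$\|f\|_p=\Big(\frac{p}{2\pi}\int_{\mathbb C}|f(z)|^p e^{-\frac p2|z|^2}\,dA(z)\Big)^{1/p}<\infty,$$ where $A$ is Lebesgue area measure, and let $\mathcal F_\infty$ be the space of entire functions $f$ with $\|f\|_\infty=\sup_{z\in\mathbb C}|f(z)|e^{-\frac12|z|^2}<\infty$. Proposition. Let $u,\psi$ be entire functions such that $u$ is not identically zero and $\psi$ is not constant, let $1\le p,q\le\infty$, and let $n\in\{0,1,2,\dots\}$. Suppose that $$D_{(u,\psi,n)}f=u\cdot\big(f^{(n)}\circ\psi\big)$$ defines a bounded linear operator $D_{(u,\psi,n)}:\mathcal F_p\to\mathcal F_q$. If the range of $D_{(u,\psi,n)}$ is closed in $\mathcal F_q$, then $p=q$. -/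

import Mathlib

open scoped ENNReal

/-- The Fock norm of `f : ℂ → ℂ`, with values in `[0, ∞]`:
`((p / 2π) ∫ |f z|^p exp (-(p/2) |z|^2) dA(z))^(1/p)` for finite `p`, and
`sup_z |f z| exp (-|z|^2 / 2)` for `p = ∞`. -/
noncomputable def fockENorm (p : ℝ≥0∞) (f : ℂ → ℂ) : ℝ≥0∞ :=
  if p = ∞ then
    ⨆ z : ℂ, ‖f z‖ₑ * ENNReal.ofReal (Real.exp (-(1 / 2) * ‖z‖ ^ 2))
  else
    (ENNReal.ofReal (p.toReal / (2 * Real.pi)) *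
      ∫⁻ z : ℂ, ‖f z‖ₑ ^ p.toReal * ENNReal.ofReal (Real.exp (-(p.toReal / 2) * ‖z‖ ^ 2)))
        ^ (1 / p.toReal)

theorem fockENorm_top (f : ℂ → ℂ) : fockENorm ∞ f =
    ⨆ z : ℂ, ‖f z‖ₑ * ENNReal.ofReal (Real.exp (-(1 / 2) * ‖z‖ ^ 2)) := if_pos rfl

theorem fockENorm_eq_eLpNorm {p : ℝ≥0∞} (h0 : p ≠ 0) (hp : p ≠ ∞) (f : ℂ → ℂ) :
    fockENorm p f = ENNReal.ofReal (p.toReal / (2 * Real.pi)) ^ (1 / p.toReal) *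
      MeasureTheory.eLpNorm (fun z : ℂ => f z * (Real.exp (-(1 / 2) * ‖z‖ ^ 2) : ℂ)) p
        MeasureTheory.volume := by
  have hpos : 0 < p.toReal := ENNReal.toReal_pos h0 hp
  rw [fockENorm, if_neg hp, MeasureTheory.eLpNorm_eq_lintegral_rpow_enorm_toReal h0 hp,
    ENNReal.mul_rpow_of_nonneg _ _ (by positivity)]
  congr 3
  ext z
  rw [enorm_mul, ENNReal.mul_rpow_of_nonneg _ _ hpos.le]
  congr 1
  have h1 : ‖((Real.exp (-(1 / 2) * ‖z‖ ^ 2) : ℝ) : ℂ)‖ₑ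
      = ENNReal.ofReal (Real.exp (-(1 / 2) * ‖z‖ ^ 2)) := by
    rw [← ofReal_norm, Complex.norm_real, Real.norm_of_nonneg (Real.exp_pos _).le]
  rw [h1, ENNReal.ofReal_rpow_of_pos (Real.exp_pos _), ← Real.exp_mul]
  congr 2
  ring

theorem fockENorm_zero {p : ℝ≥0∞} (hp : 1 ≤ p) : fockENorm p (0 : ℂ → ℂ) = 0 := by
  have h0 : p ≠ 0 := (zero_lt_one.trans_le hp).ne'
  by_cases h : p = ∞
  · subst h; simp [fockENorm_top]
  · rw [fockENorm_eq_eLpNorm h0 h]; simp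

theorem fockENorm_add_le {p : ℝ≥0∞} (hp : 1 ≤ p) {f g : ℂ → ℂ} (hf : Continuous f)
    (hg : Continuous g) : fockENorm p (f + g) ≤ fockENorm p f + fockENorm p g := by
  have h0 : p ≠ 0 := (zero_lt_one.trans_le hp).ne'
  by_cases h : p = ∞
  · subst h
    rw [fockENorm_top, fockENorm_top, fockENorm_top]
    refine iSup_le fun z => ?_
    refine (mul_le_mul_left (enorm_add_le (f z) (g z)) _).trans ?_
    rw [add_mul]
    exact add_le_add
      (le_iSup (fun z => ‖f z‖ₑ * ENNReal.ofReal (Real.exp (-(1 / 2) * ‖z‖ ^ 2))) z)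
      (le_iSup (fun z => ‖g z‖ₑ * ENNReal.ofReal (Real.exp (-(1 / 2) * ‖z‖ ^ 2))) z)
  · rw [fockENorm_eq_eLpNorm h0 h, fockENorm_eq_eLpNorm h0 h, fockENorm_eq_eLpNorm h0 h,
      ← mul_add]
    gcongr
    have hcf : Continuous fun z : ℂ => f z * (Real.exp (-(1 / 2) * ‖z‖ ^ 2) : ℂ) := by fun_prop
    have hcg : Continuous fun z : ℂ => g z * (Real.exp (-(1 / 2) * ‖z‖ ^ 2) : ℂ) := by fun_prop
    have := MeasureTheory.eLpNorm_add_le (μ := MeasureTheory.volume)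
      hcf.aestronglyMeasurable hcg.aestronglyMeasurable hp
    refine le_of_eq_of_le ?_ this
    congr 1
    funext z
    simp only [Pi.add_apply, add_mul]

theorem fockENorm_smul {p : ℝ≥0∞} (hp : 1 ≤ p) (c : ℂ) (f : ℂ → ℂ) :
    fockENorm p (c • f) = ‖c‖ₑ * fockENorm p f := by
  have h0 : p ≠ 0 := (zero_lt_one.trans_le hp).ne'
  by_cases h : p = ∞
  · subst h
    rw [fockENorm_top, fockENorm_top, ENNReal.mul_iSup]
    simp only [Pi.smul_apply, smul_eq_mul, enorm_mul, mul_assoc]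
  · rw [fockENorm_eq_eLpNorm h0 h, fockENorm_eq_eLpNorm h0 h, mul_left_comm,
      ← MeasureTheory.eLpNorm_const_smul]
    congr 2
    ext z
    simp [mul_assoc]

theorem eq_zero_of_fockENorm_eq_zero {p : ℝ≥0∞} (hp : 1 ≤ p) {f : ℂ → ℂ} (hf : Continuous f)
    (hz : fockENorm p f = 0) : f = 0 := by
  have h0 : p ≠ 0 := (zero_lt_one.trans_le hp).ne'
  by_cases h : p = ∞
  · subst h
    rw [fockENorm_top, ENNReal.iSup_eq_zero] at hz
    ext z
    have h1 := hz z
    rw [mul_eq_zero] at h1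
    rcases h1 with h1 | h1
    · simpa using h1
    · exact absurd (ENNReal.ofReal_eq_zero.1 h1) (not_le.2 (Real.exp_pos _))
  · have hpos : 0 < p.toReal := ENNReal.toReal_pos h0 h
    have hcf : Continuous fun z : ℂ => f z * (Real.exp (-(1 / 2) * ‖z‖ ^ 2) : ℂ) := by fun_prop
    rw [fockENorm_eq_eLpNorm h0 h, mul_eq_zero] at hz
    rcases hz with hz | hz
    · exfalso
      rw [ENNReal.rpow_eq_zero_iff] at hz
      rcases hz with hz | hz
      · exact absurd (ENNReal.ofReal_eq_zero.1 hz.1) (not_le.2 (by positivity))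
      · exact ENNReal.ofReal_ne_top hz.1
    · rw [MeasureTheory.eLpNorm_eq_zero_iff hcf.aestronglyMeasurable h0] at hz
      have h2 := (hcf.ae_eq_iff_eq MeasureTheory.volume continuous_const).1 hz
      ext z
      have h3 : f z * (Real.exp (-(1 / 2) * ‖z‖ ^ 2) : ℂ) = 0 := congrFun h2 z
      rcases mul_eq_zero.1 h3 with h4 | h4
      · exact h4
      · exact absurd (Complex.ofReal_eq_zero.1 h4) (Real.exp_pos _).ne'

/-- The entire functions of finite Fock norm, as a linear subspace of `ℂ → ℂ`. -/
noncomputable def fockSubmodule (p : ℝ≥0∞) [hp : Fact (1 ≤ p)] : Submodule ℂ (ℂ → ℂ) where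
  carrier := {f | Differentiable ℂ f ∧ fockENorm p f < ∞}
  zero_mem' := ⟨differentiable_const 0, by rw [fockENorm_zero hp.out]; exact ENNReal.zero_lt_top⟩
  add_mem' := fun hf hg => ⟨hf.1.add hg.1,
    (fockENorm_add_le hp.out hf.1.continuous hg.1.continuous).trans_lt
      (ENNReal.add_lt_top.2 ⟨hf.2, hg.2⟩)⟩
  smul_mem' := fun c f hf => ⟨hf.1.const_smul c, by
    rw [fockENorm_smul hp.out]; exact ENNReal.mul_lt_top enorm_lt_top hf.2⟩

/-- The Fock space `F_p`. It is a separate type, so that its only topology is the one given by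
the Fock norm (and not the topology of pointwise convergence inherited from `ℂ → ℂ`). -/
def FockSpace (p : ℝ≥0∞) [Fact (1 ≤ p)] : Type := fockSubmodule p

namespace FockSpace

variable {p : ℝ≥0∞} [hp : Fact (1 ≤ p)]

noncomputable instance : AddCommGroup (FockSpace p) :=
  inferInstanceAs (AddCommGroup (fockSubmodule p))

noncomputable instance : Module ℂ (FockSpace p) :=
  inferInstanceAs (Module ℂ (fockSubmodule p))

/-- The entire function underlying an element of the Fock space. -/
def toFun (f : FockSpace p) : ℂ → ℂ := f.1

noncomputable instance : NormedAddCommGroup (FockSpace p) :=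
  AddGroupNorm.toNormedAddCommGroup
    { toFun := fun f => (fockENorm p f.toFun).toReal
      map_zero' := by
        change (fockENorm p (0 : ℂ → ℂ)).toReal = 0
        rw [fockENorm_zero hp.out]; rfl
      add_le' := fun f g => by
        change (fockENorm p (f.toFun + g.toFun)).toReal ≤ _
        have hfin : ∀ h : FockSpace p, fockENorm p h.toFun ≠ ∞ := fun h => h.2.2.ne
        rw [← ENNReal.toReal_add (hfin f) (hfin g)]
        exact ENNReal.toReal_mono (ENNReal.add_lt_top.2 ⟨f.2.2, g.2.2⟩).ne
          (fockENorm_add_le hp.out f.2.1.continuous g.2.1.continuous)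
      neg' := fun f => by
        change (fockENorm p (-f.toFun)).toReal = _
        rw [← neg_one_smul ℂ f.toFun, fockENorm_smul hp.out]
        simp
      eq_zero_of_map_eq_zero' := fun f hf => by
        refine Subtype.ext (eq_zero_of_fockENorm_eq_zero hp.out f.2.1.continuous ?_)
        exact ((ENNReal.toReal_eq_zero_iff _).1 hf).resolve_right f.2.2.ne }

theorem norm_def (f : FockSpace p) : ‖f‖ = (fockENorm p f.toFun).toReal := rfl

noncomputable instance : NormedSpace ℂ (FockSpace p) where
  norm_smul_le := fun c f => by
    rw [norm_def, norm_def]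
    change (fockENorm p (c • f.toFun)).toReal ≤ _
    rw [fockENorm_smul hp.out, ENNReal.toReal_mul, toReal_enorm]

end FockSpace

/-- The weighted composition-differentiation `D_(u,ψ,n) f = u · (f^(n) ∘ ψ)`. -/
noncomputable def weightedCompDiff (u ψ : ℂ → ℂ) (n : ℕ) (f : ℂ → ℂ) : ℂ → ℂ :=
  fun z => u z * iteratedDeriv n f (ψ z)

/-! The proof is a gliding hump argument: the growth of the norm of a sum of `N` almost disjoint
functions reveals the exponent of a Fock space, and a closed range forces the same growth on both
sides.

Write `D` for the operator. If `D f = 0`, then `f^(n)` vanishes on the open set `ψ(ℂ)`, so `f` is a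
polynomial of degree less than `n`. Fock spaces are complete, so the open mapping theorem applies
onto the closed range; removing a Taylor polynomial then gives `‖f‖ ≤ C ‖D f‖` for all `f` vanishing
to order `n` at the origin (`exists_norm_le_mul_norm_of_isClosed_range`).

Hence the normalized monomials `e_k` of degree `k + n` and their images `D e_k = a_k u ψ^k` both
have norms bounded above and away from zero. Both sequences tend to zero locally uniformly, because
the norm of `z^k` outgrows every `R^k`. A far term is therefore almost disjoint from any given sum:
adding it raises the `q`-th power of the norm by an amount between two positive constants, or keeps
the norm bounded when the exponent is infinite (`exists_eventually_isSumOfHumps_add`).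

Choosing indices that suit both spaces at once gives `f`, a sum of `N` of the `e_k`, with `‖f‖` of
order `N^(1/p)` and `‖D f‖` of order `N^(1/q)` (merely bounded for an infinite exponent).
Boundedness of `D` forces `p ≤ q`, and the lower bound forces `q ≤ p`. -/

open MeasureTheory Filter Topology

/-! ### Mean values and point evaluations -/

/-- The area mean value property of entire functions on unit discs centred at the origin. -/
theorem integral_ball_zero_one_of_differentiable {g : ℂ → ℂ} (hg : Differentiable ℂ g) :
    ∫ ζ in Metric.ball (0 : ℂ) 1, g ζ = (Real.pi : ℂ) * g 0 := by
  have hset : ∀ p ∈ polarCoord.target,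
      p.1 • (Metric.ball (0 : ℂ) 1).indicator g (Complex.polarCoord.symm p) =
      (Set.Iio (1 : ℝ) ×ˢ (Set.univ : Set ℝ)).indicator
        (fun p : ℝ × ℝ => p.1 • g (circleMap 0 p.1 p.2)) p := by
    intro p hp
    have hp1 : 0 < p.1 := hp.1
    have hpol : Complex.polarCoord.symm p = circleMap 0 p.1 p.2 := by
      rw [Complex.polarCoord_symm_apply, circleMap, Complex.exp_mul_I]
      simp
    have hmem : (Complex.polarCoord.symm p ∈ Metric.ball (0 : ℂ) 1) ↔ p.1 < 1 := by
      rw [mem_ball_zero_iff, Complex.norm_polarCoord_symm, abs_of_pos hp1]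
    by_cases h : p.1 < 1
    · rw [Set.indicator_of_mem (hmem.2 h), Set.indicator_of_mem (by simpa using h), hpol]
    · rw [Set.indicator_of_notMem (fun h' => h (hmem.1 h')),
        Set.indicator_of_notMem (by simpa using h), smul_zero]
  have hcont : Continuous fun p : ℝ × ℝ => p.1 • g (circleMap 0 p.1 p.2) := by
    have hg' := hg.continuous
    simp only [circleMap]
    fun_prop
  -- The circle of radius `r` contributes `2πr g(0)` by the mean value property on circles;
  -- integrating over `0 < r < 1` gives `π g(0)`.
  have hinner : ∀ r : ℝ, ∫ θ in Set.Ioo (-Real.pi) Real.pi, r • g (circleMap 0 r θ) =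
      r • ((2 * Real.pi) • g 0) := by
    intro r
    rw [integral_smul]
    congr 1
    have h1 : Real.circleAverage g 0 r = g 0 := hg.diffContOnCl.circleAverage
    rw [Real.circleAverage] at h1
    rw [← integral_Ioc_eq_integral_Ioo,
      ← intervalIntegral.integral_of_le (by linarith [Real.pi_pos]), ← h1, smul_smul,
      mul_inv_cancel₀ (by positivity), one_smul]
    have hper : Function.Periodic (fun θ => g (circleMap 0 r θ)) (2 * Real.pi) :=
      fun θ => by simp only [periodic_circleMap 0 r θ]
    have := hper.intervalIntegral_add_eq (-Real.pi) 0
    rw [show -Real.pi + 2 * Real.pi = Real.pi by ring, zero_add] at this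
    exact this
  rw [← integral_indicator Metric.isOpen_ball.measurableSet,
    ← Complex.integral_comp_polarCoord_symm,
    setIntegral_congr_fun polarCoord.open_target.measurableSet hset,
    setIntegral_indicator (measurableSet_Iio.prod MeasurableSet.univ)]
  have hprod : polarCoord.target ∩ (Set.Iio (1 : ℝ) ×ˢ (Set.univ : Set ℝ)) =
      Set.Ioo (0 : ℝ) 1 ×ˢ Set.Ioo (-Real.pi) Real.pi := by
    ext p
    simp only [polarCoord_target, Set.mem_inter_iff, Set.mem_prod, Set.mem_Ioi, Set.mem_Iio,
      Set.mem_Ioo, Set.mem_univ, and_true]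
    tauto
  rw [hprod, Measure.volume_eq_prod, setIntegral_prod]
  · simp only [hinner]
    rw [integral_smul_const, ← integral_Ioc_eq_integral_Ioo,
      ← intervalIntegral.integral_of_le zero_le_one, integral_id]
    simp only [Complex.real_smul]
    push_cast
    ring
  · refine IntegrableOn.mono_set (t := Set.Icc 0 1 ×ˢ Set.Icc (-Real.pi) Real.pi) ?_
      (Set.prod_mono Set.Ioo_subset_Icc_self Set.Ioo_subset_Icc_self)
    exact hcont.continuousOn.integrableOn_compact (isCompact_Icc.prod isCompact_Icc)

/-- The area mean value property of entire functions on unit discs. -/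
theorem integral_ball_one_of_differentiable {f : ℂ → ℂ} (hf : Differentiable ℂ f) (z : ℂ) :
    ∫ ζ in Metric.ball z 1, f ζ = (Real.pi : ℂ) * f z := by
  have hg : Differentiable ℂ fun ζ => f (z + ζ) := by fun_prop
  have h := integral_ball_zero_one_of_differentiable hg
  rw [add_zero] at h
  rw [← h]
  have hmp := measurePreserving_add_left (volume : Measure ℂ) z
  have := hmp.setIntegral_preimage_emb (MeasurableEquiv.addLeft z).measurableEmbedding f
    (Metric.ball z 1)
  rw [← this]
  congr 3
  ext ζ
  simp

/-- A function on `ℂ` multiplied by the Gaussian weight `exp (-|z|² / 2)`. -/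
noncomputable def gaussianWeighted (f : ℂ → ℂ) : ℂ → ℂ :=
  fun z => f z * (Real.exp (-(1 / 2) * ‖z‖ ^ 2) : ℂ)

theorem norm_gaussianWeighted (f : ℂ → ℂ) (z : ℂ) :
    ‖gaussianWeighted f z‖ = ‖f z‖ * Real.exp (-(1 / 2) * ‖z‖ ^ 2) := by
  rw [gaussianWeighted, norm_mul, Complex.norm_real, Real.norm_of_nonneg (Real.exp_pos _).le]

theorem gaussianWeighted_add (f g : ℂ → ℂ) :
    gaussianWeighted (f + g) = gaussianWeighted f + gaussianWeighted g := by
  ext z; simp [gaussianWeighted, add_mul]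

theorem Continuous.gaussianWeighted {f : ℂ → ℂ} (hf : Continuous f) :
    Continuous (gaussianWeighted f) := by
  unfold _root_.gaussianWeighted; fun_prop

/-- The multiple of area measure that normalizes the Fock norm of exponent `p`. -/
noncomputable def fockMeasure (p : ℝ≥0∞) : Measure ℂ :=
  ENNReal.ofReal (p.toReal / (2 * Real.pi)) • volume

theorem fockENorm_eq_eLpNorm_fockMeasure {p : ℝ≥0∞} (h0 : p ≠ 0) (hp : p ≠ ∞) (f : ℂ → ℂ) :
    fockENorm p f = eLpNorm (gaussianWeighted f) p (fockMeasure p) := by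
  rw [fockENorm_eq_eLpNorm h0 hp, fockMeasure, eLpNorm_smul_measure_of_ne_top hp, smul_eq_mul]
  rw [one_div p, ENNReal.toReal_inv, one_div]
  rfl

theorem fockMeasure_scale_ne_zero {p : ℝ≥0∞} (h0 : p ≠ 0) (hp : p ≠ ∞) :
    ENNReal.ofReal (p.toReal / (2 * Real.pi)) ≠ 0 := by
  have := ENNReal.toReal_pos h0 hp
  exact (ENNReal.ofReal_pos.2 (by positivity)).ne'

theorem norm_le_exp_mul_norm_gaussianWeighted (f : ℂ → ℂ) {z : ℂ} {R : ℝ} (hz : ‖z‖ ≤ R) :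
    ‖f z‖ ≤ Real.exp (R ^ 2 / 2) * ‖gaussianWeighted f z‖ := by
  rw [norm_gaussianWeighted]
  have h1 : ‖z‖ ^ 2 ≤ R ^ 2 := by gcongr
  have h2 : 1 ≤ Real.exp (R ^ 2 / 2) * Real.exp (-(1 / 2) * ‖z‖ ^ 2) := by
    rw [← Real.exp_add]
    exact Real.one_le_exp (by linarith)
  nlinarith [norm_nonneg (f z)]

/-- Point evaluations are bounded in the Fock norm, locally uniformly. -/
theorem exists_enorm_le_fockENorm {p : ℝ≥0∞} (hp : 1 ≤ p) (R : ℝ) :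
    ∃ C : ℝ≥0∞, C ≠ ∞ ∧ ∀ f : ℂ → ℂ, Differentiable ℂ f → ∀ z : ℂ, ‖z‖ ≤ R →
      ‖f z‖ₑ ≤ C * fockENorm p f := by
  have h0 : p ≠ 0 := (zero_lt_one.trans_le hp).ne'
  by_cases htop : p = ∞
  · subst htop
    refine ⟨ENNReal.ofReal (Real.exp (R ^ 2 / 2)), ENNReal.ofReal_ne_top, fun f _ z hz => ?_⟩
    rw [fockENorm_top]
    refine le_trans ?_ (mul_le_mul_right
      (le_iSup (fun z => ‖f z‖ₑ * ENNReal.ofReal (Real.exp (-(1 / 2) * ‖z‖ ^ 2))) z) _)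
    rw [← ofReal_norm, ← ENNReal.ofReal_mul (norm_nonneg _),
      ← ENNReal.ofReal_mul (Real.exp_pos _).le, ← norm_gaussianWeighted]
    exact ENNReal.ofReal_le_ofReal (norm_le_exp_mul_norm_gaussianWeighted f hz)
  -- The mean value over the unit disc about `z` bounds `f z` by an `L^1` norm, and Hölder's
  -- inequality passes to `L^p` at the cost `V`. That disc lies in the disc of radius `R + 1`, where
  -- `E` bounds the reciprocal of the weight.
  · set E : ℝ := Real.exp ((R + 1) ^ 2 / 2) with hE
    set V : ℝ≥0∞ := (volume (Metric.ball (0 : ℂ) 1)) ^ (1 / (1 : ℝ≥0∞).toReal - 1 / p.toReal)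
      with hV
    set s : ℝ≥0∞ := ENNReal.ofReal (p.toReal / (2 * Real.pi)) ^ (1 / p.toReal) with hs
    have hptr : 1 ≤ p.toReal := by
      rw [← ENNReal.toReal_one]; exact ENNReal.toReal_mono htop hp
    have hVtop : V ≠ ∞ := by
      refine ENNReal.rpow_ne_top_of_nonneg ?_ measure_ball_lt_top.ne
      rw [ENNReal.toReal_one, div_one, sub_nonneg, div_le_one (by linarith)]
      exact hptr
    have hs0 : s ≠ 0 := by
      rw [hs, Ne, ENNReal.rpow_eq_zero_iff]
      rintro (h | h)
      · exact fockMeasure_scale_ne_zero h0 htop h.1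
      · exact ENNReal.ofReal_ne_top h.1
    have hsfin : s ≠ ∞ := ENNReal.rpow_ne_top_of_nonneg (by positivity) ENNReal.ofReal_ne_top
    set P : ℝ≥0∞ := ENNReal.ofReal Real.pi with hP
    have hP0 : P ≠ 0 := (ENNReal.ofReal_pos.2 Real.pi_pos).ne'
    refine ⟨P⁻¹ * (ENNReal.ofReal E * V * s⁻¹), ?_, fun f hf z hz => ?_⟩
    · exact ENNReal.mul_ne_top (ENNReal.inv_ne_top.2 hP0)
        (ENNReal.mul_ne_top (ENNReal.mul_ne_top ENNReal.ofReal_ne_top hVtop)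
          (ENNReal.inv_ne_top.2 hs0))
    have hmean : P * ‖f z‖ₑ ≤ eLpNorm f 1 (volume.restrict (Metric.ball z 1)) := by
      have h1 := enorm_integral_le_lintegral_enorm (μ := volume.restrict (Metric.ball z 1)) f
      rw [integral_ball_one_of_differentiable hf, enorm_mul] at h1
      rw [eLpNorm_one_eq_lintegral_enorm]
      refine le_of_eq_of_le ?_ h1
      rw [hP, ← ofReal_norm (Real.pi : ℂ), Complex.norm_real,
        Real.norm_of_nonneg Real.pi_pos.le]
    have hvol : (volume.restrict (Metric.ball z 1)) Set.univ = volume (Metric.ball (0 : ℂ) 1) := by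
      rw [Measure.restrict_apply_univ, Measure.addHaar_ball_center]
    have h2 : eLpNorm f 1 (volume.restrict (Metric.ball z 1)) ≤
        eLpNorm f p (volume.restrict (Metric.ball z 1)) * V := by
      have := eLpNorm_le_eLpNorm_mul_rpow_measure_univ
        (μ := volume.restrict (Metric.ball z 1)) hp hf.continuous.aestronglyMeasurable
      rwa [hvol] at this
    have h3 : eLpNorm f p (volume.restrict (Metric.ball z 1)) ≤
        ENNReal.ofReal E * eLpNorm (gaussianWeighted f) p volume := by
      refine (eLpNorm_le_mul_eLpNorm_of_ae_le_mul
        ((ae_restrict_mem Metric.isOpen_ball.measurableSet).mono fun x hx => ?_) p).trans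
        (mul_le_mul_right (eLpNorm_mono_measure _ Measure.restrict_le_self) _)
      refine norm_le_exp_mul_norm_gaussianWeighted f ?_
      have hx' : ‖x - z‖ < 1 := by rwa [Metric.mem_ball, dist_eq_norm] at hx
      have := norm_add_le (x - z) z
      rw [sub_add_cancel] at this
      linarith
    have h4 : fockENorm p f = s * eLpNorm (gaussianWeighted f) p volume :=
      fockENorm_eq_eLpNorm h0 htop f
    have h5 : eLpNorm (gaussianWeighted f) p volume = s⁻¹ * fockENorm p f := by
      rw [h4, ← mul_assoc, ENNReal.inv_mul_cancel hs0 hsfin, one_mul]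
    rw [mul_assoc, ← ENNReal.div_eq_inv_mul, ENNReal.le_div_iff_mul_le (Or.inl hP0)
      (Or.inl ENNReal.ofReal_ne_top), mul_comm]
    calc P * ‖f z‖ₑ ≤ ENNReal.ofReal E * eLpNorm (gaussianWeighted f) p volume * V :=
          hmean.trans (h2.trans (mul_le_mul_left h3 V))
      _ = ENNReal.ofReal E * V * s⁻¹ * fockENorm p f := by rw [h5]; ring

/-- Fatou's lemma for the Fock norm. -/
theorem fockENorm_le_of_tendsto {p : ℝ≥0∞} (hp : 1 ≤ p) {F : ℕ → ℂ → ℂ} {f : ℂ → ℂ}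
    (hF : ∀ m, Continuous (F m)) (hlim : ∀ z, Tendsto (fun m => F m z) atTop (𝓝 (f z)))
    {c : ℝ≥0∞} (hc : ∀ᶠ m in atTop, fockENorm p (F m) ≤ c) : fockENorm p f ≤ c := by
  by_cases htop : p = ∞
  · subst htop
    rw [fockENorm_top]
    refine iSup_le fun z => ?_
    have h1 : Tendsto (fun m => ‖F m z‖ₑ * ENNReal.ofReal (Real.exp (-(1 / 2) * ‖z‖ ^ 2))) atTop
        (𝓝 (‖f z‖ₑ * ENNReal.ofReal (Real.exp (-(1 / 2) * ‖z‖ ^ 2)))) :=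
      ENNReal.Tendsto.mul_const (hlim z).enorm (Or.inr ENNReal.ofReal_ne_top)
    refine le_of_tendsto h1 (hc.mono fun m hm => le_trans ?_ hm)
    rw [fockENorm_top]
    exact le_iSup (fun z => ‖F m z‖ₑ * ENNReal.ofReal (Real.exp (-(1 / 2) * ‖z‖ ^ 2))) z
  · have h0 : p ≠ 0 := (zero_lt_one.trans_le hp).ne'
    rw [fockENorm_eq_eLpNorm_fockMeasure h0 htop]
    refine (Lp.eLpNorm_lim_le_liminf_eLpNorm (f := fun m => gaussianWeighted (F m))
      (fun m => (hF m).gaussianWeighted.aestronglyMeasurable) _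
      (Eventually.of_forall fun z => (hlim z).mul_const _)).trans ?_
    refine liminf_le_of_le (by isBoundedDefault) fun b hb => ?_
    obtain ⟨m, hm1, hm2⟩ := (hb.and hc).exists
    rw [fockENorm_eq_eLpNorm_fockMeasure h0 htop] at hm2
    exact hm1.trans hm2

/-! ### Completeness of the Fock spaces -/

namespace FockSpace

variable {p : ℝ≥0∞} [hp : Fact (1 ≤ p)]

theorem differentiable (f : FockSpace p) : Differentiable ℂ f.toFun := f.2.1

theorem fockENorm_toFun_ne_top (f : FockSpace p) : fockENorm p f.toFun ≠ ∞ := f.2.2.ne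

theorem fockENorm_toFun (f : FockSpace p) : fockENorm p f.toFun = ENNReal.ofReal ‖f‖ := by
  rw [norm_def, ENNReal.ofReal_toReal f.fockENorm_toFun_ne_top]

theorem ext_toFun {f g : FockSpace p} (h : f.toFun = g.toFun) : f = g := Subtype.ext h

theorem toFun_add (f g : FockSpace p) : (f + g).toFun = f.toFun + g.toFun := rfl

theorem toFun_sub (f g : FockSpace p) : (f - g).toFun = f.toFun - g.toFun := rfl

theorem toFun_smul (c : ℂ) (f : FockSpace p) : (c • f).toFun = c • f.toFun := rfl

theorem toFun_zero : (0 : FockSpace p).toFun = 0 := rfl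

theorem toFun_sum {ι : Type*} (s : Finset ι) (f : ι → FockSpace p) :
    (∑ i ∈ s, f i).toFun = ∑ i ∈ s, (f i).toFun := by
  classical
  induction s using Finset.induction_on with
  | empty => rfl
  | insert i s hi ih => rw [Finset.sum_insert hi, Finset.sum_insert hi, toFun_add, ih]

variable (p) in
/-- Point evaluations are bounded on Fock spaces, locally uniformly. -/
theorem exists_norm_apply_le (R : ℝ) :
    ∃ C : ℝ, 0 ≤ C ∧ ∀ f : FockSpace p, ∀ z : ℂ, ‖z‖ ≤ R → ‖f.toFun z‖ ≤ C * ‖f‖ := by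
  obtain ⟨C, hC, h⟩ := exists_enorm_le_fockENorm hp.out R
  refine ⟨C.toReal, ENNReal.toReal_nonneg, fun f z hz => ?_⟩
  have h1 := ENNReal.toReal_mono (ENNReal.mul_ne_top hC f.fockENorm_toFun_ne_top)
    (h f.toFun f.differentiable z hz)
  rwa [toReal_enorm, ENNReal.toReal_mul, ← norm_def] at h1

/-- Bounded point evaluations make a Cauchy sequence converge locally uniformly, so the limit is
entire; Fatou's lemma applied to `F k - F m` as `k` grows turns this into convergence in norm.
Completeness is what the open mapping theorem requires later. -/
instance : CompleteSpace (FockSpace p) := by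
  refine Metric.complete_of_cauchySeq_tendsto fun F hF => ?_
  have hunif : ∀ R : ℝ, UniformCauchySeqOn (fun m => (F m).toFun) atTop
      (Metric.closedBall (0 : ℂ) R) := by
    intro R
    obtain ⟨C, hC0, hC⟩ := exists_norm_apply_le p R
    rw [Metric.uniformCauchySeqOn_iff]
    intro ε hε
    obtain ⟨N, hN⟩ := Metric.cauchySeq_iff.1 hF (ε / (C + 1)) (by positivity)
    refine ⟨N, fun m hm k hk z hz => ?_⟩
    have h1 := hC (F m - F k) z (mem_closedBall_zero_iff.1 hz)
    have h2 := hN m hm k hk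
    rw [dist_eq_norm] at h2 ⊢
    rw [toFun_sub, Pi.sub_apply] at h1
    calc _ ≤ C * ‖F m - F k‖ := h1
      _ ≤ (C + 1) * ‖F m - F k‖ := by gcongr; linarith
      _ < (C + 1) * (ε / (C + 1)) := by gcongr
      _ = ε := by field_simp
  have hpt : ∀ z : ℂ, ∃ w, Tendsto (fun m => (F m).toFun z) atTop (𝓝 w) := fun z =>
    cauchySeq_tendsto_of_complete
      ((hunif ‖z‖).cauchySeq (by simp))
  choose g hg using hpt
  have hloc : TendstoLocallyUniformlyOn (fun m => (F m).toFun) g atTop Set.univ := by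
    rw [tendstoLocallyUniformlyOn_iff_forall_isCompact isOpen_univ]
    intro K _ hK
    obtain ⟨R, hR⟩ := hK.isBounded.subset_closedBall 0
    exact ((hunif R).tendstoUniformlyOn_of_tendsto fun z _ => hg z).mono hR
  have hgd : Differentiable ℂ g := by
    rw [← differentiableOn_univ]
    exact hloc.differentiableOn
      (Eventually.of_forall fun m => (F m).differentiable.differentiableOn) isOpen_univ
  have hdist : ∀ ε : ℝ, 0 < ε → ∃ N, ∀ m ≥ N, fockENorm p (g - (F m).toFun) ≤
      ENNReal.ofReal ε := by
    intro ε hε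
    obtain ⟨N, hN⟩ := Metric.cauchySeq_iff.1 hF ε hε
    refine ⟨N, fun m hm => ?_⟩
    refine fockENorm_le_of_tendsto hp.out (F := fun k => (F k - F m).toFun)
      (fun k => (F k - F m).differentiable.continuous)
      (fun z => (hg z).sub_const _) ?_
    filter_upwards [eventually_ge_atTop N] with k hk
    rw [fockENorm_toFun, ← dist_eq_norm]
    exact ENNReal.ofReal_le_ofReal (hN k hk m hm).le
  have hgfin : fockENorm p g < ∞ := by
    obtain ⟨N, hN⟩ := hdist 1 one_pos
    have h1 := fockENorm_add_le hp.out (hgd.continuous.sub (F N).differentiable.continuous)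
      (F N).differentiable.continuous
    rw [sub_add_cancel] at h1
    exact h1.trans_lt (ENNReal.add_lt_top.2
      ⟨(hN N le_rfl).trans_lt ENNReal.ofReal_lt_top, (F N).2.2⟩)
  let G : FockSpace p := ⟨g, hgd, hgfin⟩
  refine ⟨G, Metric.tendsto_atTop.2 fun ε hε => ?_⟩
  obtain ⟨N, hN⟩ := hdist (ε / 2) (half_pos hε)
  refine ⟨N, fun m hm => ?_⟩
  have h1 : fockENorm p (G - F m).toFun ≤ ENNReal.ofReal (ε / 2) := hN m hm
  rw [dist_comm, dist_eq_norm]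
  rw [fockENorm_toFun, ENNReal.ofReal_le_ofReal_iff (half_pos hε).le] at h1
  linarith

/-- Derivatives at the origin are bounded functionals on Fock spaces. -/
theorem exists_norm_iteratedDeriv_zero_le (j : ℕ) :
    ∃ C : ℝ, 0 ≤ C ∧ ∀ f : FockSpace p, ‖iteratedDeriv j f.toFun 0‖ ≤ C * ‖f‖ := by
  obtain ⟨C, hC0, hC⟩ := exists_norm_apply_le p 1
  refine ⟨j.factorial * C, by positivity, fun f => ?_⟩
  have := Complex.norm_iteratedDeriv_le_of_forall_mem_sphere_norm_le (c := (0 : ℂ)) (R := 1)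
    (C := C * ‖f‖) j one_pos f.differentiable.diffContOnCl
    fun z hz => hC f z (mem_sphere_zero_iff_norm.1 hz).le
  rwa [one_pow, div_one, ← mul_assoc] at this

end FockSpace

/-! ### Monomials and the growth of their norms -/

/-- Powers of `z` are dominated by an arbitrarily narrow Gaussian growth. -/
theorem exists_norm_pow_mul_exp_le (k : ℕ) :
    ∃ C : ℝ, 0 ≤ C ∧ ∀ z : ℂ, ‖gaussianWeighted (fun z => z ^ k) z‖ ≤
      C * Real.exp (-(1 / 4) * ‖z‖ ^ 2) := by
  -- The product is read off the `k`-th term of the exponential series at `‖z‖ ^ 2 / 4`; the summand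
  -- `1` covers the unit disc, where `‖z‖ ^ k` is not below `‖z‖ ^ (2 * k)`.
  refine ⟨4 ^ k * k.factorial + 1, by positivity, fun z => ?_⟩
  rw [norm_gaussianWeighted, norm_pow]
  have h1 : ‖z‖ ^ k ≤ (4 ^ k * k.factorial + 1) * Real.exp (1 / 4 * ‖z‖ ^ 2) := by
    have hexp : 1 ≤ Real.exp (1 / 4 * ‖z‖ ^ 2) := Real.one_le_exp (by positivity)
    by_cases hz : ‖z‖ ≤ 1
    · have : ‖z‖ ^ k ≤ 1 := pow_le_one₀ (norm_nonneg _) hz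
      nlinarith [show (0 : ℝ) ≤ 4 ^ k * k.factorial by positivity]
    · have h2 := Real.pow_div_factorial_le_exp (x := 1 / 4 * ‖z‖ ^ 2) (by positivity) k
      rw [div_le_iff₀ (by positivity), mul_pow, div_pow, one_pow, ← pow_mul] at h2
      have h3 : ‖z‖ ^ k ≤ ‖z‖ ^ (2 * k) := pow_le_pow_right₀ (not_le.1 hz).le (by omega)
      have h4 : ‖z‖ ^ (2 * k) ≤ 4 ^ k * k.factorial * Real.exp (1 / 4 * ‖z‖ ^ 2) := by
        rw [div_mul_eq_mul_div, one_mul, div_le_iff₀ (by positivity)] at h2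
        linarith
      nlinarith
  calc _ ≤ (4 ^ k * k.factorial + 1) * Real.exp (1 / 4 * ‖z‖ ^ 2) *
        Real.exp (-(1 / 2) * ‖z‖ ^ 2) := by gcongr
    _ = _ := by rw [mul_assoc, ← Real.exp_add]; ring_nf

theorem integrable_exp_neg_mul_norm_sq {b : ℝ} (hb : 0 < b) :
    Integrable fun z : ℂ => Real.exp (-b * ‖z‖ ^ 2) := by
  have h := GaussianFourier.integrable_cexp_neg_mul_sq_norm_add (V := ℂ) (b := b)
    (by simpa using hb) 0 0
  refine h.norm.congr (Eventually.of_forall fun z => ?_)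
  simp only [zero_mul, add_zero, Complex.norm_exp]
  norm_cast

theorem fockENorm_pow_lt_top {p : ℝ≥0∞} (hp : 1 ≤ p) (k : ℕ) :
    fockENorm p (fun z => z ^ k) < ∞ := by
  have h0 : p ≠ 0 := (zero_lt_one.trans_le hp).ne'
  obtain ⟨C, hC0, hC⟩ := exists_norm_pow_mul_exp_le k
  by_cases htop : p = ∞
  · subst htop
    rw [fockENorm_top]
    refine lt_of_le_of_lt (iSup_le fun z => ?_) (ENNReal.ofReal_lt_top (r := C))
    rw [← ofReal_norm, ← ENNReal.ofReal_mul (norm_nonneg _)]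
    have hz := hC z
    rw [norm_gaussianWeighted] at hz
    refine ENNReal.ofReal_le_ofReal (hz.trans (mul_le_of_le_one_right hC0 ?_))
    exact Real.exp_le_one_iff.2 (by nlinarith [sq_nonneg ‖z‖])
  · have hpos : 0 < p.toReal := ENNReal.toReal_pos h0 htop
    rw [fockENorm_eq_eLpNorm_fockMeasure h0 htop]
    have h1 : MemLp (fun z : ℂ => Real.exp (-(1 / 4) * ‖z‖ ^ 2)) p volume := by
      rw [← integrable_norm_rpow_iff (by fun_prop) h0 htop]
      refine (integrable_exp_neg_mul_norm_sq (b := p.toReal / 4) (by positivity)).congr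
        (Eventually.of_forall fun z => ?_)
      simp only [Real.norm_of_nonneg (Real.exp_pos _).le]
      rw [← Real.exp_mul]
      ring_nf
    have h2 : MemLp (gaussianWeighted fun z => z ^ k) p volume :=
      h1.of_le_mul (continuous_id.pow k).gaussianWeighted.aestronglyMeasurable
        (c := C) (Eventually.of_forall fun z => by
          rw [Real.norm_of_nonneg (Real.exp_pos _).le]; exact hC z)
    exact (h2.smul_measure ENNReal.ofReal_ne_top).2

namespace FockSpace

variable {p : ℝ≥0∞} [hp : Fact (1 ≤ p)]

variable (p) in
/-- The monomial `z ^ k` as an element of the Fock space. -/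
noncomputable def monomial (k : ℕ) : FockSpace p :=
  ⟨fun z => z ^ k, by fun_prop, fockENorm_pow_lt_top hp.out k⟩

theorem toFun_monomial (k : ℕ) : (monomial p k).toFun = fun z => z ^ k := rfl

theorem norm_monomial_pos (k : ℕ) : 0 < ‖monomial p k‖ := by
  refine norm_pos_iff.2 fun h => ?_
  have := congrFun (congrArg toFun h) 1
  simp [toFun_monomial, toFun_zero] at this

/-- Monomial norms grow superexponentially. -/
theorem exists_pow_le_mul_norm_monomial {R : ℝ} (hR : 0 ≤ R) :
    ∃ C : ℝ, 0 ≤ C ∧ ∀ k, R ^ k ≤ C * ‖monomial p k‖ := by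
  obtain ⟨C, hC0, hC⟩ := exists_norm_apply_le p R
  refine ⟨C, hC0, fun k => ?_⟩
  have hn : ‖(R : ℂ)‖ = R := by rw [Complex.norm_real, Real.norm_of_nonneg hR]
  have := hC (monomial p k) R hn.le
  rwa [toFun_monomial, norm_pow, hn] at this

/-- Factorially-polynomial multiples of `R ^ k` are negligible compared with monomial norms. -/
theorem tendsto_descFactorial_div_norm_monomial (n : ℕ) (R : ℝ) :
    Tendsto (fun k => ((k + n).descFactorial n / ‖monomial p (k + n)‖) * R ^ k) atTop (𝓝 0) := by
  -- The factor 2 yields a decay `2 ^ (-k)` that beats the polynomial `(k + n) ^ n`; the added 1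
  -- makes the base at least 1, so that the exponent can be raised from `k` to `k + n`.
  obtain ⟨C, hC0, hC⟩ := exists_pow_le_mul_norm_monomial (p := p) (R := 2 * |R| + 1)
    (by positivity)
  have h1 : Tendsto (fun k : ℕ => C * 2 ^ n * (((k + n : ℕ) : ℝ) ^ n * (1 / 2) ^ (k + n)))
      atTop (𝓝 0) := by
    have := (tendsto_pow_const_mul_const_pow_of_abs_lt_one n (r := 1 / 2)
      (by norm_num [abs_of_pos])).comp (tendsto_add_atTop_nat n)
    simpa using this.const_mul (C * 2 ^ n)
  refine squeeze_zero_norm (fun k => ?_) h1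
  have hpos := norm_monomial_pos (p := p) (k + n)
  have hdesc : (((k + n).descFactorial n : ℕ) : ℝ) ≤ ((k + n : ℕ) : ℝ) ^ n := by
    exact_mod_cast Nat.descFactorial_le_pow _ _
  rw [norm_mul, norm_pow, Real.norm_eq_abs R, norm_div, norm_norm, Real.norm_natCast]
  have h2 : |R| ^ k ≤ C * 2 ^ n * (1 / 2) ^ (k + n) * ‖monomial p (k + n)‖ := by
    have h3 : (2 * |R|) ^ k ≤ C * ‖monomial p (k + n)‖ := by
      refine le_trans ?_ (hC (k + n))
      calc (2 * |R|) ^ k ≤ (2 * |R| + 1) ^ k := by gcongr; linarith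
        _ ≤ (2 * |R| + 1) ^ (k + n) :=
          pow_le_pow_right₀ (by linarith [abs_nonneg R]) (by omega)
    rw [mul_pow] at h3
    have h4 : |R| ^ k = (1 / 2) ^ k * (2 ^ k * |R| ^ k) := by
      rw [← mul_assoc, ← mul_pow]; norm_num
    have h5 : (2 : ℝ) ^ n * (1 / 2) ^ (k + n) = (1 / 2) ^ k := by
      rw [pow_add, mul_left_comm, ← mul_pow]; norm_num
    rw [h4, mul_assoc C, h5]
    calc _ ≤ (1 / 2 : ℝ) ^ k * (C * ‖monomial p (k + n)‖) := by gcongr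
      _ = _ := by ring
  rw [div_mul_eq_mul_div, div_le_iff₀ hpos]
  calc _ ≤ ((k + n : ℕ) : ℝ) ^ n * (C * 2 ^ n * (1 / 2) ^ (k + n) * ‖monomial p (k + n)‖) := by
        gcongr
    _ = _ := by ring

end FockSpace

/-! ### Almost disjoint functions in `L^q` -/

section LpGlide

variable {α : Type*} [MeasurableSpace α] {μ : Measure α} {q : ℝ≥0∞}

/-- The `q`-th power of the `L^q` norm is additive over a set and its complement. -/
theorem eLpNorm_toReal_rpow_add_compl (h0 : q ≠ 0) (hq : q ≠ ∞) {g : α → ℂ} (hg : MemLp g q μ)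
    {s : Set α} (hs : MeasurableSet s) :
    (eLpNorm g q (μ.restrict s)).toReal ^ q.toReal + (eLpNorm g q (μ.restrict sᶜ)).toReal ^ q.toReal
      = (eLpNorm g q μ).toReal ^ q.toReal := by
  have hpos : 0 < q.toReal := ENNReal.toReal_pos h0 hq
  have hpow : ∀ ν : Measure α, eLpNorm g q ν ^ q.toReal = ∫⁻ x, ‖g x‖ₑ ^ q.toReal ∂ν := fun ν => by
    rw [eLpNorm_eq_lintegral_rpow_enorm_toReal h0 hq, ← ENNReal.rpow_mul,
      one_div_mul_cancel hpos.ne', ENNReal.rpow_one]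
  have hfin : ∀ t : Set α, eLpNorm g q (μ.restrict t) ^ q.toReal ≠ ∞ := fun t =>
    ENNReal.rpow_ne_top_of_nonneg hpos.le (hg.restrict t).2.ne
  rw [ENNReal.toReal_rpow, ENNReal.toReal_rpow, ENNReal.toReal_rpow,
    ← ENNReal.toReal_add (hfin _) (hfin _), hpow, hpow, hpow, lintegral_add_compl _ hs]

theorem eLpNorm_toReal_add_le (h1 : 1 ≤ q) {f g : α → ℂ} (hf : MemLp f q μ) (hg : MemLp g q μ) :
    (eLpNorm (f + g) q μ).toReal ≤ (eLpNorm f q μ).toReal + (eLpNorm g q μ).toReal := by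
  rw [← ENNReal.toReal_add hf.2.ne hg.2.ne]
  exact ENNReal.toReal_mono (ENNReal.add_lt_top.2 ⟨hf.2, hg.2⟩).ne (eLpNorm_add_le hf.1 hg.1 h1)

theorem abs_eLpNorm_toReal_add_sub_le (h1 : 1 ≤ q) {f g : α → ℂ} (hf : MemLp f q μ)
    (hg : MemLp g q μ) :
    |(eLpNorm (f + g) q μ).toReal - (eLpNorm f q μ).toReal| ≤ (eLpNorm g q μ).toReal := by
  have h2 := eLpNorm_toReal_add_le h1 (hf.add hg) hg.neg
  rw [add_neg_cancel_right, eLpNorm_neg] at h2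
  rw [abs_le]
  constructor
  · linarith
  · linarith [eLpNorm_toReal_add_le h1 hf hg]

theorem eLpNorm_toReal_restrict_le {g : α → ℂ} (hg : MemLp g q μ) (s : Set α) :
    (eLpNorm g q (μ.restrict s)).toReal ≤ (eLpNorm g q μ).toReal :=
  ENNReal.toReal_mono hg.2.ne (eLpNorm_mono_measure _ Measure.restrict_le_self)

/-- The `q`-th powers add up over the two pieces, and `a ^ q + b ^ q ≤ (a + b) ^ q` for `q ≥ 1`. No
measurability beyond that of the set is needed for the pieces. -/
theorem eLpNorm_toReal_le_add_compl (h1 : 1 ≤ q) (hq : q ≠ ∞) {g : α → ℂ} (hg : MemLp g q μ)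
    {s : Set α} (hs : MeasurableSet s) :
    (eLpNorm g q μ).toReal ≤
      (eLpNorm g q (μ.restrict s)).toReal + (eLpNorm g q (μ.restrict sᶜ)).toReal := by
  have hq1 : 1 ≤ q.toReal := by
    rw [← ENNReal.toReal_one]; exact ENNReal.toReal_mono hq h1
  have h := eLpNorm_toReal_rpow_add_compl (zero_lt_one.trans_le h1).ne' hq hg hs
  set a := (eLpNorm g q (μ.restrict s)).toReal with ha
  set b := (eLpNorm g q (μ.restrict sᶜ)).toReal with hb
  have ha0 : 0 ≤ a := ENNReal.toReal_nonneg
  have hb0 : 0 ≤ b := ENNReal.toReal_nonneg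
  have h2 := Real.add_rpow_le_rpow_add ha0 hb0 hq1
  rw [h] at h2
  exact (Real.rpow_le_rpow_iff ENNReal.toReal_nonneg (by positivity) (by linarith)).1 h2

/-- Adding a far term of a seminormalized sequence that vanishes locally changes the `q`-th power
of an `L^q` norm by an amount bounded above and below. -/
theorem eventually_eLpNorm_add_rpow_bounds (h1 : 1 ≤ q) (hq : q ≠ ∞) {c C : ℝ} (hc : 0 < c)
    {g : α → ℂ} (hg : MemLp g q μ) {y : ℕ → α → ℂ} (hy : ∀ k, MemLp (y k) q μ)
    (hyc : ∀ k, c ≤ (eLpNorm (y k) q μ).toReal) (hyC : ∀ k, (eLpNorm (y k) q μ).toReal ≤ C)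
    (hloc : ∀ ε : ℝ, 0 < ε → ∃ s, MeasurableSet s ∧ (eLpNorm g q (μ.restrict sᶜ)).toReal ≤ ε ∧
      Tendsto (fun k => (eLpNorm (y k) q (μ.restrict s)).toReal) atTop (𝓝 0)) :
    ∀ᶠ k in atTop,
      (eLpNorm g q μ).toReal ^ q.toReal + (c / 2) ^ q.toReal / 2 ≤
        (eLpNorm (g + y k) q μ).toReal ^ q.toReal ∧
      (eLpNorm (g + y k) q μ).toReal ^ q.toReal ≤
        (eLpNorm g q μ).toReal ^ q.toReal + ((C + 1) ^ q.toReal + 1) := by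
  have h0 : q ≠ 0 := (zero_lt_one.trans_le h1).ne'
  have hq1 : 1 ≤ q.toReal := by
    rw [← ENNReal.toReal_one]; exact ENNReal.toReal_mono hq h1
  -- Essentially `g` lives on `s` and `y k` off `s`. Off `s` the sum keeps norm at least `c - c/4 -
  -- c/4 = c/2`. The `q`-th power loses at most `η` on `s` and another `η` by neglecting `g` off
  -- `s`, in all at most half of `(c / 2) ^ q`.
  set η : ℝ := min 1 ((c / 2) ^ q.toReal / 4) with hη
  have hηpos : 0 < η := by positivity
  set ε : ℝ := min η (c / 4) with hε
  have hεpos : 0 < ε := by positivity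
  obtain ⟨s, hs, hgs, hys⟩ := hloc ε hεpos
  have hgsη : (eLpNorm g q (μ.restrict sᶜ)).toReal ^ q.toReal ≤ η := by
    have hle1 : (eLpNorm g q (μ.restrict sᶜ)).toReal ≤ 1 :=
      hgs.trans ((min_le_left _ _).trans (min_le_left _ _))
    refine (Real.rpow_le_rpow_of_exponent_ge' ENNReal.toReal_nonneg hle1 zero_le_one hq1).trans ?_
    rw [Real.rpow_one]
    exact hgs.trans (min_le_left _ _)
  have hlim : Tendsto (fun k => (eLpNorm (g + y k) q (μ.restrict s)).toReal) atTop
      (𝓝 (eLpNorm g q (μ.restrict s)).toReal) := by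
    rw [tendsto_iff_norm_sub_tendsto_zero]
    exact squeeze_zero (fun _ => norm_nonneg _)
      (fun k => abs_eLpNorm_toReal_add_sub_le h1 (hg.restrict s) ((hy k).restrict s)) hys
  have hlim' := (hlim.rpow_const (p := q.toReal) (Or.inr (by linarith))).eventually
    (Metric.ball_mem_nhds _ hηpos)
  filter_upwards [hlim', hys.eventually (gt_mem_nhds (show (0 : ℝ) < c / 4 by positivity))]
    with k hk1 hk2
  have e1 := eLpNorm_toReal_rpow_add_compl h0 hq hg hs
  have e2 := eLpNorm_toReal_rpow_add_compl h0 hq (hg.add (hy k)) hs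
  rw [Real.dist_eq, abs_lt] at hk1
  have hgy := abs_eLpNorm_toReal_add_sub_le h1 ((hy k).restrict sᶜ) (hg.restrict sᶜ)
  rw [add_comm (y k), abs_le] at hgy
  have hup : (eLpNorm (g + y k) q (μ.restrict sᶜ)).toReal ≤ C + 1 := by
    have := (eLpNorm_toReal_restrict_le (hy k) sᶜ).trans (hyC k)
    have : ε ≤ 1 := (min_le_left _ _).trans (min_le_left _ _)
    linarith
  have hlow : c / 2 ≤ (eLpNorm (g + y k) q (μ.restrict sᶜ)).toReal := by
    have := (hyc k).trans (eLpNorm_toReal_le_add_compl h1 hq (hy k) hs)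
    have : ε ≤ c / 4 := min_le_right _ _
    linarith
  have hup' := Real.rpow_le_rpow ENNReal.toReal_nonneg hup (show 0 ≤ q.toReal by linarith)
  have hlow' := Real.rpow_le_rpow (by positivity) hlow (show 0 ≤ q.toReal by linarith)
  have hη1 : η ≤ 1 := min_le_left _ _
  have hη2 : η ≤ (c / 2) ^ q.toReal / 4 := min_le_right _ _
  have hnn : 0 ≤ (eLpNorm g q (μ.restrict sᶜ)).toReal ^ q.toReal := by positivity
  constructor <;> linarith

/-- On a locally compact space an `L^q` function has small norm off some compact set. -/
theorem MeasureTheory.MemLp.exists_isCompact_eLpNorm_compl_le {ν : Measure ℂ} [ν.Regular]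
    (hq : q ≠ ∞) {g : ℂ → ℂ} (hg : MemLp g q ν) {ε : ℝ} (hε : 0 < ε) :
    ∃ s, IsCompact s ∧ (eLpNorm g q (ν.restrict sᶜ)).toReal ≤ ε := by
  obtain ⟨h, hh, hle, -, -⟩ :=
    hg.exists_hasCompactSupport_eLpNorm_sub_le hq (ENNReal.ofReal_pos.2 hε).ne'
  refine ⟨tsupport h, hh, ?_⟩
  have h1 : eLpNorm g q (ν.restrict (tsupport h)ᶜ) =
      eLpNorm (g - h) q (ν.restrict (tsupport h)ᶜ) := by
    refine eLpNorm_congr_ae ((ae_restrict_mem hh.measurableSet.compl).mono fun x hx => ?_)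
    rw [Pi.sub_apply, image_eq_zero_of_notMem_tsupport hx, sub_zero]
  rw [h1]
  exact ENNReal.toReal_le_of_le_ofReal hε.le
    ((eLpNorm_mono_measure _ Measure.restrict_le_self).trans hle)

end LpGlide

/-! ### Sums of humps in a Fock space -/

namespace FockSpace

variable {q : ℝ≥0∞} [hq : Fact (1 ≤ q)]

theorem norm_eq_eLpNorm (htop : q ≠ ∞) (f : FockSpace q) :
    ‖f‖ = (eLpNorm (gaussianWeighted f.toFun) q (fockMeasure q)).toReal := by
  rw [norm_def, fockENorm_eq_eLpNorm_fockMeasure (zero_lt_one.trans_le hq.out).ne' htop]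

theorem memLp_gaussianWeighted (htop : q ≠ ∞) (f : FockSpace q) :
    MemLp (gaussianWeighted f.toFun) q (fockMeasure q) := by
  refine ⟨f.differentiable.continuous.gaussianWeighted.aestronglyMeasurable, ?_⟩
  rw [← fockENorm_eq_eLpNorm_fockMeasure (zero_lt_one.trans_le hq.out).ne' htop]
  exact f.fockENorm_toFun_ne_top.lt_top

theorem norm_gaussianWeighted_le (htop : q = ∞) (f : FockSpace q) (z : ℂ) :
    ‖gaussianWeighted f.toFun z‖ ≤ ‖f‖ := by
  subst htop
  have h1 : ‖f.toFun z‖ₑ * ENNReal.ofReal (Real.exp (-(1 / 2) * ‖z‖ ^ 2)) ≤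
      fockENorm ∞ f.toFun := by
    rw [fockENorm_top]
    exact le_iSup (fun z => ‖f.toFun z‖ₑ * ENNReal.ofReal (Real.exp (-(1 / 2) * ‖z‖ ^ 2))) z
  rw [← ofReal_norm, ← ENNReal.ofReal_mul (norm_nonneg _), ← norm_gaussianWeighted,
    fockENorm_toFun] at h1
  exact (ENNReal.ofReal_le_ofReal_iff (norm_nonneg _)).1 h1

theorem norm_le_of_forall_gaussianWeighted (htop : q = ∞) (f : FockSpace q) {M : ℝ} (hM : 0 ≤ M)
    (h : ∀ z, ‖gaussianWeighted f.toFun z‖ ≤ M) : ‖f‖ ≤ M := by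
  subst htop
  have h1 : fockENorm ∞ f.toFun ≤ ENNReal.ofReal M := by
    rw [fockENorm_top]
    refine iSup_le fun z => ?_
    rw [← ofReal_norm, ← ENNReal.ofReal_mul (norm_nonneg _), ← norm_gaussianWeighted]
    exact ENNReal.ofReal_le_ofReal (h z)
  rw [fockENorm_toFun] at h1
  exact (ENNReal.ofReal_le_ofReal_iff hM).1 h1

/-- `IsSumOfHumps ψ κ K N g` says that `g` has the size of a sum of `N` almost disjoint functions
of comparable norms: its `q`-th power norm is between `κ N` and `K N` when `q` is finite; for
`q = ∞`, the norm is less than `K` and `g` decays where `ψ` is large. -/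
def IsSumOfHumps (ψ : ℂ → ℂ) (κ K : ℝ) (N : ℕ) (g : FockSpace q) : Prop :=
  (q ≠ ∞ → κ * N ≤ ‖g‖ ^ q.toReal ∧ ‖g‖ ^ q.toReal ≤ K * N) ∧
  (q = ∞ → ‖g‖ < K ∧
    ∀ ε : ℝ, 0 < ε → ∃ R, 0 ≤ R ∧ ∀ z, R < ‖ψ z‖ → ‖gaussianWeighted g.toFun z‖ ≤ ε)

theorem isSumOfHumps_zero (ψ : ℂ → ℂ) (κ : ℝ) {K : ℝ} (hK : 0 < K) :
    IsSumOfHumps ψ κ K 0 (0 : FockSpace q) := by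
  refine ⟨fun h => ?_, fun h => ⟨by simpa using hK, fun ε hε => ⟨0, le_rfl, fun z _ => ?_⟩⟩⟩
  · have : q.toReal ≠ 0 := (ENNReal.toReal_pos (zero_lt_one.trans_le hq.out).ne' h).ne'
    simp [Real.zero_rpow this]
  · simpa [gaussianWeighted, toFun_zero] using hε.le

variable {u ψ : ℂ → ℂ} {y : ℕ → FockSpace q} {a : ℕ → ℝ}

/-- Since `y 0` is a multiple of `u`, all terms are compared with `y 0` through powers of `ψ` alone,
and no separate estimate of `u` is needed. -/
theorem norm_gaussianWeighted_of_eq_mul_pow (ha : ∀ k, 0 < a k)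
    (hy : ∀ k z, (y k).toFun z = a k * (u z * ψ z ^ k)) (k : ℕ) (z : ℂ) :
    ‖gaussianWeighted (y k).toFun z‖ =
      a k * ‖ψ z‖ ^ k / a 0 * ‖gaussianWeighted (y 0).toFun z‖ := by
  have h0 := (ha 0).ne'
  simp only [norm_gaussianWeighted, hy, norm_mul, norm_pow, Complex.norm_real,
    Real.norm_of_nonneg (ha _).le, pow_zero, mul_one]
  field_simp

theorem norm_gaussianWeighted_le_of_eq_mul_pow (ha : ∀ k, 0 < a k)
    (hy : ∀ k z, (y k).toFun z = a k * (u z * ψ z ^ k)) (k : ℕ) {z : ℂ} {R : ℝ}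
    (hz : ‖ψ z‖ ≤ R) :
    ‖gaussianWeighted (y k).toFun z‖ ≤ a k * R ^ k / a 0 * ‖gaussianWeighted (y 0).toFun z‖ := by
  have h0 := ha 0
  have hk := ha k
  rw [norm_gaussianWeighted_of_eq_mul_pow ha hy]
  gcongr

/-- The gliding hump step: for a seminormalized sequence `a k • u ψ ^ k` in a Fock space, adding
a far term to a sum of `N` humps gives a sum of `N + 1` humps. -/
theorem exists_eventually_isSumOfHumps_add {c C : ℝ} (hc : 0 < c) (hψ : Continuous ψ)
    (ha : ∀ k, 0 < a k) (haR : ∀ R : ℝ, Tendsto (fun k => a k * R ^ k) atTop (𝓝 0))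
    (hy : ∀ k z, (y k).toFun z = a k * (u z * ψ z ^ k)) (hyc : ∀ k, c ≤ ‖y k‖)
    (hyC : ∀ k, ‖y k‖ ≤ C) :
    ∃ κ K : ℝ, 0 < κ ∧ 0 < K ∧ ∀ N (g : FockSpace q), IsSumOfHumps ψ κ K N g →
      ∀ᶠ k in atTop, IsSumOfHumps ψ κ K (N + 1) (g + y k) := by
  have hC : 0 < C := hc.trans_le ((hyc 0).trans (hyC 0))
  have ha0 := ha 0
  by_cases htop : q = ∞
  -- Where `‖ψ‖ > R` the old sum is at most `1/2` and the new term at most `C`; elsewhere the new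
  -- term is at most half of the gap between `‖g‖` and `C + 1`. The strict bound on `‖g‖` keeps this
  -- gap positive. The first constant plays no role for `q = ∞`.
  · refine ⟨1, C + 1, one_pos, by positivity, fun N g hg => ?_⟩
    obtain ⟨hgK, hgd⟩ := hg.2 htop
    obtain ⟨R, hR0, hR⟩ := hgd (1 / 2) (by norm_num)
    have hlim : Tendsto (fun k => a k * R ^ k / a 0 * C) atTop (𝓝 0) := by
      simpa using ((haR R).div_const (a 0)).mul_const C
    have hδ : 0 < (C + 1 - ‖g‖) / 2 := by linarith
    filter_upwards [hlim.eventually (gt_mem_nhds hδ)] with k hk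
    refine ⟨fun h => absurd htop h, fun _ => ⟨?_, fun ε hε => ?_⟩⟩
    · refine lt_of_le_of_lt (norm_le_of_forall_gaussianWeighted htop (g + y k)
        (M := max (C + 1 / 2) ((C + 1 + ‖g‖) / 2)) (le_max_of_le_left (by positivity))
        fun z => ?_) (max_lt (by linarith) (by linarith))
      rw [toFun_add, gaussianWeighted_add, Pi.add_apply]
      refine (norm_add_le _ _).trans ?_
      by_cases hz : R < ‖ψ z‖
      · refine le_max_of_le_left ?_
        have := (norm_gaussianWeighted_le htop (y k) z).trans (hyC k)
        linarith [hR z hz]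
      · refine le_max_of_le_right ?_
        have h1 := norm_gaussianWeighted_le_of_eq_mul_pow ha hy k (not_lt.1 hz)
        have h2 : a k * R ^ k / a 0 * ‖gaussianWeighted (y 0).toFun z‖ ≤ a k * R ^ k / a 0 * C := by
          have := ha k
          gcongr
          exact (norm_gaussianWeighted_le htop (y 0) z).trans (hyC 0)
        linarith [norm_gaussianWeighted_le htop g z]
    · obtain ⟨R₁, hR₁, h1⟩ := hgd (ε / 2) (by positivity)
      have hak := ha k
      have hak1 := ha (k + 1)
      -- The decay of `y k` comes from the next term: `y (k + 1)` is bounded and is a constant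
      -- multiple of `ψ * y k`, so the weighted `y k` is `O(1 / ‖ψ‖)`.
      refine ⟨max R₁ (a k / a (k + 1) * C / (ε / 2)), le_max_of_le_left hR₁, fun z hz => ?_⟩
      rw [toFun_add, gaussianWeighted_add, Pi.add_apply]
      refine (norm_add_le _ _).trans ?_
      have h2 := h1 z ((le_max_left _ _).trans_lt hz)
      have h3 := (le_max_right _ _).trans_lt hz
      have hψz : 0 < ‖ψ z‖ := lt_of_le_of_lt (by positivity) h3
      have h4 : ‖gaussianWeighted (y k).toFun z‖ * ‖ψ z‖ ≤ a k / a (k + 1) * C := by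
        have h5 := (norm_gaussianWeighted_le htop (y (k + 1)) z).trans (hyC (k + 1))
        have h6 : ‖gaussianWeighted (y k).toFun z‖ * ‖ψ z‖ =
            a k / a (k + 1) * ‖gaussianWeighted (y (k + 1)).toFun z‖ := by
          rw [norm_gaussianWeighted_of_eq_mul_pow ha hy,
            norm_gaussianWeighted_of_eq_mul_pow ha hy (k + 1), pow_succ]
          field_simp
        rw [h6]
        gcongr
      rw [div_lt_iff₀ (by positivity)] at h3
      have h7 : ‖gaussianWeighted (y k).toFun z‖ ≤ ε / 2 := by
        refine le_of_mul_le_mul_right (h4.trans (h3.le.trans_eq (mul_comm _ _))) hψz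
      linarith
  · have : (fockMeasure q).Regular := Measure.Regular.smul ENNReal.ofReal_ne_top
    refine ⟨(c / 2) ^ q.toReal / 2, (C + 1) ^ q.toReal + 1, by positivity, by positivity,
      fun N g hg => ?_⟩
    obtain ⟨hgl, hgu⟩ := hg.1 htop
    have hev := eventually_eLpNorm_add_rpow_bounds (c := c) (C := C) hq.out htop hc
      (memLp_gaussianWeighted htop g) (y := fun k => gaussianWeighted (y k).toFun)
      (fun k => memLp_gaussianWeighted htop (y k))
      (fun k => (hyc k).trans_eq (norm_eq_eLpNorm htop _))
      (fun k => (norm_eq_eLpNorm htop (y k)).symm.trans_le (hyC k)) fun ε hε => by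
        obtain ⟨s, hs, hsε⟩ :=
          (memLp_gaussianWeighted htop g).exists_isCompact_eLpNorm_compl_le htop hε
        refine ⟨s, hs.measurableSet, hsε, ?_⟩
        -- On the compact set `s` the function `ψ` is bounded, so there `y k` is at most `a k * |R|
        -- ^ k / a 0` times `y 0`. The absolute value is taken because `R` may be negative when `s`
        -- is empty.
        obtain ⟨R, hR⟩ := hs.exists_bound_of_continuousOn hψ.continuousOn
        have hlim : Tendsto (fun k => a k * |R| ^ k / a 0 * C) atTop (𝓝 0) := by
          simpa using ((haR |R|).div_const (a 0)).mul_const C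
        refine squeeze_zero (fun _ => ENNReal.toReal_nonneg) (fun k => ?_) hlim
        have hak := ha k
        have h1 : eLpNorm (gaussianWeighted (y k).toFun) q ((fockMeasure q).restrict s) ≤
            ENNReal.ofReal (a k * |R| ^ k / a 0) *
              eLpNorm (gaussianWeighted (y 0).toFun) q ((fockMeasure q).restrict s) :=
          eLpNorm_le_mul_eLpNorm_of_ae_le_mul
            ((ae_restrict_mem hs.measurableSet).mono fun x hx =>
              norm_gaussianWeighted_le_of_eq_mul_pow ha hy k ((hR x hx).trans (le_abs_self R))) q
        have h2 := ENNReal.toReal_mono (ENNReal.mul_ne_top ENNReal.ofReal_ne_top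
          ((memLp_gaussianWeighted htop (y 0)).restrict s).2.ne) h1
        rw [ENNReal.toReal_mul, ENNReal.toReal_ofReal (by positivity)] at h2
        refine h2.trans ?_
        gcongr
        refine (eLpNorm_toReal_restrict_le (memLp_gaussianWeighted htop (y 0)) s).trans ?_
        rw [← norm_eq_eLpNorm htop]
        exact hyC 0
    filter_upwards [hev] with k hk
    rw [← gaussianWeighted_add, ← toFun_add, ← norm_eq_eLpNorm htop, ← norm_eq_eLpNorm htop] at hk
    refine ⟨fun _ => ?_, fun h => absurd h htop⟩
    push_cast
    constructor <;> linarith [hk.1, hk.2]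

end FockSpace

/-! ### Lower bound from the closed range -/

/-- If `u` is a nonzero entire function and `ψ` a nonconstant one, then weighted composition
`h ↦ u · (h ∘ ψ)` is injective on entire functions. -/
theorem eq_zero_of_mul_comp_eq_zero {u ψ h : ℂ → ℂ} (hu : Differentiable ℂ u) (hu0 : u ≠ 0)
    (hψ : Differentiable ℂ ψ) (hψc : ¬ ∃ b : ℂ, ∀ z : ℂ, ψ z = b) (hh : Differentiable ℂ h)
    (hz : ∀ z, u z * h (ψ z) = 0) : h = 0 := by
  have han : ∀ {g : ℂ → ℂ}, Differentiable ℂ g → AnalyticOnNhd ℂ g Set.univ := fun hg =>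
    hg.differentiableOn.analyticOnNhd isOpen_univ
  have h1 : ∀ z, h (ψ z) = 0 := by
    rcases (han hu).eq_zero_or_eq_zero_of_mul_eq_zero (han (hh.comp hψ)) (fun z _ => hz z)
      isPreconnected_univ with h2 | h2
    · exact absurd (funext fun z => h2 z trivial) hu0
    · exact fun z => h2 z trivial
  -- A nonconstant `ψ` has open image, and the identity theorem spreads the vanishing of `h` from
  -- there to the plane.
  rcases (han hψ).is_constant_or_isOpen isPreconnected_univ with ⟨w, hw⟩ | hopen
  · exact absurd ⟨w, fun z => hw z trivial⟩ hψc
  · refine (han hh).eq_of_eventuallyEq (z₀ := ψ 0) (analyticOnNhd_const) ?_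
    filter_upwards [(hopen Set.univ subset_rfl isOpen_univ).mem_nhds
      (Set.mem_image_of_mem ψ trivial)]
      with w hw
    obtain ⟨z, -, rfl⟩ := hw
    exact h1 z

namespace FockSpace

variable {p q : ℝ≥0∞} [hp : Fact (1 ≤ p)] [hq : Fact (1 ≤ q)]

/-- The Taylor polynomial of degree less than `n` at the origin. -/
noncomputable def taylorPart (n : ℕ) (f : FockSpace p) : FockSpace p :=
  ∑ j ∈ Finset.range n, (((j.factorial : ℂ))⁻¹ * iteratedDeriv j f.toFun 0) • monomial p j

theorem exists_norm_taylorPart_le (n : ℕ) :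
    ∃ C : ℝ, 0 ≤ C ∧ ∀ f : FockSpace p, ‖taylorPart n f‖ ≤ C * ‖f‖ := by
  choose C hC0 hC using fun j => exists_norm_iteratedDeriv_zero_le (p := p) j
  refine ⟨∑ j ∈ Finset.range n, ‖((j.factorial : ℂ))⁻¹‖ * C j * ‖monomial p j‖,
    Finset.sum_nonneg fun j _ => mul_nonneg (mul_nonneg (norm_nonneg _) (hC0 j)) (norm_nonneg _),
    fun f => ?_⟩
  rw [taylorPart, Finset.sum_mul]
  refine (norm_sum_le _ _).trans (Finset.sum_le_sum fun j _ => ?_)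
  rw [norm_smul, norm_mul]
  calc _ ≤ ‖((j.factorial : ℂ))⁻¹‖ * (C j * ‖f‖) * ‖monomial p j‖ := by
        gcongr
        exact hC j f
    _ = _ := by ring

/-- A function vanishing to order `n` at the origin is recovered from any other function with the
same `n`-th derivative by removing the Taylor part. -/
theorem eq_sub_taylorPart {n : ℕ} {f x : FockSpace p}
    (hf : ∀ j < n, iteratedDeriv j f.toFun 0 = 0)
    (hfx : iteratedDeriv n (x - f).toFun = 0) : f = x - taylorPart n x := by
  rw [eq_sub_iff_add_eq, ← eq_sub_iff_add_eq']
  refine ext_toFun (funext fun z => ?_)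
  -- The entire function `x - f` equals its Taylor series; the coefficients vanish from order `n`
  -- on, and below order `n` they are those of `x`.
  have hhigh : ∀ j, n ≤ j → iteratedDeriv j (x - f).toFun 0 = 0 := by
    intro j hj
    obtain ⟨i, rfl⟩ := Nat.exists_eq_add_of_le' hj
    rw [iteratedDeriv_eq_iterate, Function.iterate_add_apply, ← iteratedDeriv_eq_iterate (n := n),
      hfx, ← iteratedDeriv_eq_iterate]
    change iteratedDeriv i (fun _ => (0 : ℂ)) 0 = 0
    simp
  have hlow : ∀ j < n, iteratedDeriv j (x - f).toFun 0 = iteratedDeriv j x.toFun 0 := by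
    intro j hj
    rw [toFun_sub, iteratedDeriv_sub x.differentiable.contDiff.contDiffAt
      f.differentiable.contDiff.contDiffAt, hf j hj, sub_zero]
  rw [← Complex.taylorSeries_eq_of_entire' 0 z (x - f).differentiable,
    tsum_eq_sum (s := Finset.range n) fun j hj => by
      rw [hhigh j (by simpa using hj), mul_zero, zero_mul], taylorPart, toFun_sum,
    Finset.sum_apply]
  refine Finset.sum_congr rfl fun j hj => ?_
  rw [hlow j (Finset.mem_range.1 hj), toFun_smul, toFun_monomial, Pi.smul_apply, smul_eq_mul,
    sub_zero]

/-- A weighted composition-differentiation operator with closed range is bounded below on the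
functions that vanish to order `n` at the origin. -/
theorem exists_norm_le_mul_norm_of_isClosed_range {n : ℕ} {u ψ : ℂ → ℂ}
    (hu : Differentiable ℂ u) (hu0 : u ≠ 0) (hψ : Differentiable ℂ ψ)
    (hψc : ¬ ∃ b : ℂ, ∀ z : ℂ, ψ z = b) (T : FockSpace p →L[ℂ] FockSpace q)
    (hT : ∀ f : FockSpace p, (T f).toFun = weightedCompDiff u ψ n f.toFun)
    (hclosed : IsClosed (Set.range T)) :
    ∃ C : ℝ, 0 < C ∧ ∀ f : FockSpace p, (∀ j < n, iteratedDeriv j f.toFun 0 = 0) →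
      ‖f‖ ≤ C * ‖T f‖ := by
  obtain ⟨A, hA0, hA⟩ := exists_norm_taylorPart_le (p := p) n
  have : CompleteSpace T.range := by
    have h : IsClosed (T.range : Set (FockSpace q)) := hclosed
    exact h.completeSpace_coe
  -- The open mapping theorem gives some preimage `x` of `T f` of controlled norm, not `f` itself.
  -- The two differ by a polynomial of degree less than `n`, and removing the Taylor part of `x`
  -- recovers `f` at the cost of the factor `1 + A`.
  obtain ⟨B, hB0, hB⟩ := T.rangeRestrict.exists_preimage_norm_le
    (LinearMap.surjective_rangeRestrict _)
  refine ⟨(1 + A) * B, by positivity, fun f hf => ?_⟩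
  obtain ⟨x, hx, hxn⟩ := hB (T.rangeRestrict f)
  have hTx : T (x - f) = 0 := by
    rw [map_sub, sub_eq_zero]
    exact congrArg Subtype.val hx
  have hder : iteratedDeriv n (x - f).toFun = 0 := by
    refine eq_zero_of_mul_comp_eq_zero hu hu0 hψ hψc
      ((x - f).differentiable.contDiff.differentiable_iteratedDeriv n (WithTop.coe_lt_top _))
      fun z => ?_
    have := congrFun (hT (x - f)) z
    rw [hTx] at this
    exact this.symm
  have hxn' : ‖x‖ ≤ B * ‖T f‖ := hxn
  calc ‖f‖ = ‖x - taylorPart n x‖ := by rw [← eq_sub_taylorPart hf hder]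
    _ ≤ ‖x‖ + A * ‖x‖ := (norm_sub_le _ _).trans (by gcongr; exact hA x)
    _ = (1 + A) * ‖x‖ := by ring
    _ ≤ (1 + A) * (B * ‖T f‖) := by gcongr
    _ = _ := by ring

/-! ### Comparison of the exponents -/

/-- A linear function of `N` is not bounded by a multiple of a smaller power of `N`. -/
theorem exists_mul_rpow_lt {c B s : ℝ} (hc : 0 < c) (hs : s < 1) :
    ∃ N : ℕ, B * (N : ℝ) ^ s < c * N := by
  have h1 := ((tendsto_rpow_atTop (sub_pos.2 hs)).comp
    tendsto_natCast_atTop_atTop).eventually_gt_atTop (B / c)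
  obtain ⟨N, hN, hN1⟩ := (h1.and (eventually_ge_atTop 1)).exists
  refine ⟨N, ?_⟩
  have hNpos : (0 : ℝ) < N := by exact_mod_cast hN1
  rw [Function.comp_apply, div_lt_iff₀ hc] at hN
  calc B * (N : ℝ) ^ s < (N : ℝ) ^ (1 - s) * c * (N : ℝ) ^ s := by gcongr
    _ = c * ((N : ℝ) ^ (1 - s) * (N : ℝ) ^ s) := by ring
    _ = c * N := by rw [← Real.rpow_add hNpos]; simp

/-- Comparing the norms of sums of `N` humps compares the exponents. -/
theorem exponent_le_of_isSumOfHumps {φ ψ : ℂ → ℂ} {κ K κ' K' D : ℝ} (hK : 0 < K) (hκ' : 0 < κ')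
    (hD : 0 ≤ D)
    (h : ∀ N : ℕ, ∃ (f : FockSpace p) (g : FockSpace q), IsSumOfHumps φ κ K N f ∧
      IsSumOfHumps ψ κ' K' N g ∧ ‖g‖ ≤ D * ‖f‖) : p ≤ q := by
  by_contra! hqp
  have hqtop : q ≠ ∞ := hqp.ne_top
  have hqpos : 0 < q.toReal := ENNReal.toReal_pos (zero_lt_one.trans_le hq.out).ne' hqtop
  -- If `q < p`, then `‖f‖ ^ q` grows at most like `N ^ (q / p)`, or stays bounded for `p = ∞`,
  -- whereas `‖g‖ ^ q` is at least `κ' N`.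
  suffices hs : ∃ B s : ℝ, s < 1 ∧ ∀ (N : ℕ) (f : FockSpace p), IsSumOfHumps φ κ K N f →
      ‖f‖ ^ q.toReal ≤ B * (N : ℝ) ^ s by
    obtain ⟨B, s, hs, hB⟩ := hs
    obtain ⟨N, hN⟩ := exists_mul_rpow_lt (B := D ^ q.toReal * B) hκ' hs
    obtain ⟨f, g, hf, hg, hgf⟩ := h N
    have h1 := (hg.1 hqtop).1
    have h2 := Real.rpow_le_rpow (norm_nonneg g) hgf hqpos.le
    rw [Real.mul_rpow hD (norm_nonneg f)] at h2
    have h3 : D ^ q.toReal * ‖f‖ ^ q.toReal ≤ D ^ q.toReal * (B * (N : ℝ) ^ s) := by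
      gcongr
      exact hB N f hf
    linarith
  by_cases hptop : p = ∞
  · refine ⟨K ^ q.toReal, 0, one_pos, fun N f hf => ?_⟩
    rw [Real.rpow_zero, mul_one]
    exact Real.rpow_le_rpow (norm_nonneg f) (hf.2 hptop).1.le hqpos.le
  · have hlt : q.toReal < p.toReal := ENNReal.toReal_strict_mono hptop hqp
    have hppos := hqpos.trans hlt
    refine ⟨K ^ (q.toReal / p.toReal), q.toReal / p.toReal, (div_lt_one hppos).2 hlt,
      fun N f hf => ?_⟩
    rw [← Real.mul_rpow hK.le (Nat.cast_nonneg N)]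
    have h1 := Real.rpow_le_rpow (by positivity) (hf.1 hptop).2
      (show 0 ≤ q.toReal / p.toReal by positivity)
    rwa [← Real.rpow_mul (norm_nonneg f), mul_div_cancel₀ _ hppos.ne'] at h1

variable (p) in
/-- The normalized monomials of degree at least `n`. -/
noncomputable def unitMonomial (n k : ℕ) : FockSpace p :=
  ((‖monomial p (k + n)‖⁻¹ : ℝ) : ℂ) • monomial p (k + n)

theorem norm_unitMonomial (n k : ℕ) : ‖unitMonomial p n k‖ = 1 := by
  have := norm_monomial_pos (p := p) (k + n)
  rw [unitMonomial, norm_smul, Complex.norm_real, Real.norm_of_nonneg (by positivity),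
    inv_mul_cancel₀ this.ne']

theorem iteratedDeriv_unitMonomial (n k j : ℕ) (z : ℂ) :
    iteratedDeriv j (unitMonomial p n k).toFun z =
      ((‖monomial p (k + n)‖⁻¹ : ℝ) : ℂ) * ((k + n).descFactorial j * z ^ (k + n - j)) := by
  rw [unitMonomial, toFun_smul, iteratedDeriv_const_smul_field, toFun_monomial,
    iteratedDeriv_pow, smul_eq_mul]

/-- The hump step holds for all far indices in either space, so a common index serves `f` and `T f`
together; by linearity the image of the enlarged sum is the enlarged image. -/
theorem exists_isSumOfHumps_pair {n : ℕ} {u ψ : ℂ → ℂ} (hψ : Continuous ψ)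
    (T : FockSpace p →L[ℂ] FockSpace q)
    (hT : ∀ f : FockSpace p, (T f).toFun = weightedCompDiff u ψ n f.toFun) {C : ℝ} (hC : 0 < C)
    (hbelow : ∀ f : FockSpace p, (∀ j < n, iteratedDeriv j f.toFun 0 = 0) → ‖f‖ ≤ C * ‖T f‖) :
    ∃ κ K κ' K' : ℝ, 0 < κ ∧ 0 < K ∧ 0 < κ' ∧ 0 < K' ∧ ∀ N : ℕ, ∃ f : FockSpace p,
      (∀ j < n, iteratedDeriv j f.toFun 0 = 0) ∧ IsSumOfHumps id κ K N f ∧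
        IsSumOfHumps ψ κ' K' N (T f) := by
  have hvan : ∀ k, ∀ j < n, iteratedDeriv j (unitMonomial p n k).toFun 0 = 0 := fun k j hj => by
    rw [iteratedDeriv_unitMonomial, zero_pow (by omega), mul_zero, mul_zero]
  have hpos : ∀ k, 0 < ‖monomial p (k + n)‖ := fun k => norm_monomial_pos _
  have hdesc : ∀ k, (1 : ℝ) ≤ (k + n).descFactorial n := fun k => by
    exact_mod_cast Nat.one_le_iff_ne_zero.2 (Nat.descFactorial_eq_zero_iff_lt.not.2 (by omega))
  -- The unit monomials fit the pattern `a k * (u * ψ ^ k)` with `u = z ^ n` and `ψ` the identity.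
  obtain ⟨κ, K, hκ, hK, hstep⟩ := exists_eventually_isSumOfHumps_add (q := p) (u := fun z => z ^ n)
    (ψ := id) (y := unitMonomial p n) (a := fun k => ‖monomial p (k + n)‖⁻¹) (c := 1) (C := 1)
    one_pos continuous_id (fun k => inv_pos.2 (hpos k)) (fun R => by
      refine squeeze_zero_norm (fun k => ?_)
        (tendsto_descFactorial_div_norm_monomial (p := p) n |R|)
      rw [norm_mul, norm_pow, Real.norm_eq_abs R, Real.norm_of_nonneg (inv_pos.2 (hpos k)).le,
        ← one_div]
      have := hpos k
      gcongr
      exact hdesc k)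
    (fun k z => by
      simp only [unitMonomial, toFun_smul, toFun_monomial, Pi.smul_apply, smul_eq_mul, id]
      rw [pow_add, mul_comm (z ^ k)])
    (fun k => (norm_unitMonomial n k).ge) (fun k => (norm_unitMonomial n k).le)
  -- Differentiating `n` times turns `z ^ (k + n)` into a multiple of `z ^ k`, so the images have
  -- the same pattern with the given `u` and `ψ`. The lower bound for `T` keeps their norms above
  -- `C⁻¹`.
  obtain ⟨κ', K', hκ', hK', hstep'⟩ := exists_eventually_isSumOfHumps_add (u := u) (ψ := ψ)
    (y := fun k => T (unitMonomial p n k))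
    (a := fun k => (k + n).descFactorial n / ‖monomial p (k + n)‖) (c := C⁻¹) (C := ‖T‖)
    (inv_pos.2 hC) hψ (fun k => div_pos (by linarith [hdesc k]) (hpos k))
    (fun R => tendsto_descFactorial_div_norm_monomial n R)
    (fun k z => by
      rw [hT, weightedCompDiff, iteratedDeriv_unitMonomial, Nat.add_sub_cancel]
      push_cast
      ring)
    (fun k => by
      have := hbelow _ (hvan k)
      rwa [norm_unitMonomial, ← inv_le_iff_one_le_mul₀' hC] at this)
    (fun k => by simpa [norm_unitMonomial] using T.le_opNorm (unitMonomial p n k))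
  refine ⟨κ, K, κ', K', hκ, hK, hκ', hK', fun N => ?_⟩
  induction N with
  | zero =>
    refine ⟨0, fun j _ => ?_, isSumOfHumps_zero _ _ hK, ?_⟩
    · change iteratedDeriv j (fun _ => (0 : ℂ)) 0 = 0
      simp
    · rw [map_zero]
      exact isSumOfHumps_zero _ _ hK'
  | succ N ih =>
    obtain ⟨f, hf, h1, h2⟩ := ih
    obtain ⟨k, hk1, hk2⟩ := ((hstep N f h1).and (hstep' N (T f) h2)).exists
    refine ⟨f + unitMonomial p n k, fun j hj => ?_, hk1, by rwa [map_add]⟩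
    rw [toFun_add, iteratedDeriv_add f.differentiable.contDiff.contDiffAt
      (unitMonomial p n k).differentiable.contDiff.contDiffAt, hf j hj, hvan k j hj, add_zero]

end FockSpace

theorem mainTheorem4 (p q : ℝ≥0∞) [Fact (1 ≤ p)] [Fact (1 ≤ q)] (n : ℕ) (u ψ : ℂ → ℂ)
    (hu : Differentiable ℂ u) (hu0 : u ≠ 0)
    (hψ : Differentiable ℂ ψ) (hψc : ¬ ∃ b : ℂ, ∀ z : ℂ, ψ z = b)
    (T : FockSpace p →L[ℂ] FockSpace q)
    (hT : ∀ f : FockSpace p, (T f).toFun = weightedCompDiff u ψ n f.toFun)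
    (hclosed : IsClosed (Set.range T)) :
    p = q := by
  obtain ⟨C, hC, hbelow⟩ :=
    FockSpace.exists_norm_le_mul_norm_of_isClosed_range hu hu0 hψ hψc T hT hclosed
  obtain ⟨κ, K, κ', K', hκ, hK, hκ', hK', h⟩ :=
    FockSpace.exists_isSumOfHumps_pair hψ.continuous T hT hC hbelow
  -- The bound `‖T f‖ ≤ ‖T‖ ‖f‖` gives `p ≤ q`; the bound `‖f‖ ≤ C ‖T f‖` gives `q ≤ p` with the
  -- roles of the two spaces exchanged.
  refine le_antisymm
    (FockSpace.exponent_le_of_isSumOfHumps (φ := id) (ψ := ψ) (κ := κ) (K' := K') hK hκ'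
      (norm_nonneg T) fun N => ?_)
    (FockSpace.exponent_le_of_isSumOfHumps (φ := ψ) (ψ := id) (κ := κ') (K' := K) hK' hκ hC.le
      fun N => ?_)
  · obtain ⟨f, -, h1, h2⟩ := h N
    exact ⟨f, T f, h1, h2, T.le_opNorm f⟩
  · obtain ⟨f, hf, h1, h2⟩ := h N
    exact ⟨T f, f, h2, h1, hbelow f hf⟩
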